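/- Let $A \in \mathbb{Z}^{m\times n}$, $b \in \mathbb{Z}^m$ and $c \in \mathbb{R}^n$, and let $\Delta$ denote the largest absolute value of the determinant of a (nonempty) square submatrix of $A$. For $I \subseteq [n] := \{1,\dots,n\}$ let ($I$-MIP) denote the mixed-integer linear program $$\max\{c^\intercal x : x \in \mathbb{R}^n,\ Ax \le b,\ x_i \in \mathbb{Z} \text{ for all } i \in I\},$$ so that ($\emptyset$-MIP) is a linear program and ($[n]$-MIP) is a pure integer program. Assume that $1 \le \Delta \le 2$ (that is, $A \neq 0$ and $\Delta \le 2$), and let $I, J \in \{\emptyset, [n]\}$ be such that ($J$-MIP) has an optimal solution. Then for every optimal solution $w$ of ($I$-MIP) there exists an optimal solution $z$ of ($J$-MIP) such that $\|w - z\|_\infty \le \Delta$. -/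

import Mathlib

open scoped Matrix

/-- `Δ(A)`: the largest absolute value of the determinant of a (nonempty) square submatrix of `A`.
The rows and columns of the submatrix are selected by injections; their order only affects the
sign of the determinant. -/
noncomputable def maxSubdet {m n : ℕ} (A : Matrix (Fin m) (Fin n) ℤ) : ℕ :=
  (Finset.Icc 1 (min m n)).sup fun k =>
    (Finset.univ : Finset (Fin k ↪ Fin m)).sup fun r =>
      (Finset.univ : Finset (Fin k ↪ Fin n)).sup fun s =>
        (A.submatrix r s).det.natAbs

/-- The feasible region of the mixed-integer program:
`{x ∈ ℝⁿ : A x ≤ b, x_i ∈ ℤ for all i ∈ I}`. -/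
def mipFeasible {m n : ℕ} (A : Matrix (Fin m) (Fin n) ℤ) (b : Fin m → ℤ) (I : Set (Fin n)) :
    Set (Fin n → ℝ) :=
  {x | (∀ i, (A.map (Int.cast : ℤ → ℝ) *ᵥ x) i ≤ (b i : ℝ)) ∧ ∀ j ∈ I, ∃ k : ℤ, x j = (k : ℝ)}

/-- `x` is an optimal solution of `max {cᵀ x : A x ≤ b, x_i ∈ ℤ for all i ∈ I}`. -/
def IsMIPOptimal {m n : ℕ} (A : Matrix (Fin m) (Fin n) ℤ) (b : Fin m → ℤ) (c : Fin n → ℝ)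
    (I : Set (Fin n)) (x : Fin n → ℝ) : Prop :=
  x ∈ mipFeasible A b I ∧ ∀ y ∈ mipFeasible A b I, c ⬝ᵥ y ≤ c ⬝ᵥ x

/-!
The basic step moves any feasible `w` of the linear program close to an integral feasible `z` that
does at least as well as a given integral feasible `y` on the constraints tight at `w`. Put the
identity below `A`, which does not increase the subdeterminants, and call the result `M`. First
replace `w` by a vertex `v` of the box `⌊M w⌋ ≤ M v ≤ ⌈M w⌉`; since `b` is integral, `v` is feasible
and keeps the tight constraints. The integral entries of `M v` belong to spanning rows, so by
Cramer's rule `v` is integral or, when `Δ = 2`, half-integral with `x = 2 v` not even. In the second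
case decompose `2 y - x` conformally into elementary vectors of the rows where `M x` is even.
Cramer's rule bounds the entries of `M` times such a vector by `2`, and a matrix of determinant `±2`
has a kernel of dimension one modulo two, so each such vector is even or congruent to `x`. If `g` is
one of the second kind, `z = (x + g) / 2` is integral, feasible, and within distance one of `v`.

For an optimum `w` of the linear program and an integral optimum `y`, the tight constraints force
`c z ≥ c y`. In the other direction, let `y` be the linear optimum nearest to the integral optimum
`w`, and let `z` be integral, close to `y`, and as good as `w` on the constraints tight at `y`. Then
`c w = c z`, and moving `y` slightly along `w - z` keeps it optimal; if `‖w - y‖ > Δ`, this would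
bring it closer to `w`.
-/

open scoped Topology

section Divisibility

variable {ι κ R : Type*} [Fintype κ] [CommRing R]

theorem dvd_mulVec {d : R} (M : Matrix ι κ R) {x : κ → R} (hx : ∀ j, d ∣ x j) (i : ι) :
    d ∣ (M *ᵥ x) i :=
  Finset.dvd_sum fun j _ => (hx j).mul_left _

variable [DecidableEq κ]

theorem dvd_det_of_dvd_mulVec {p : R} (hp : Prime p) (N : Matrix κ κ R) {x : κ → R}
    (hNx : ∀ k, p ∣ (N *ᵥ x) k) (hx : ∃ j, ¬p ∣ x j) : p ∣ N.det := by
  obtain ⟨j, hj⟩ := hx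
  have hdet : p ∣ N.det * x j := by
    simpa [Matrix.mulVec_mulVec, Matrix.adjugate_mul, Matrix.smul_mulVec] using
      dvd_mulVec N.adjugate hNx j
  exact (hp.dvd_or_dvd hdet).resolve_right hj

theorem isUnit_det_of_det_dvd_adjugate [IsDomain R] {N : Matrix κ κ R} (h0 : N.det ≠ 0)
    (h : ∀ i j, N.det ∣ N.adjugate i j) : IsUnit N.det := by
  choose K hK using h
  have hadj : N.adjugate = N.det • Matrix.of K := by
    ext i j
    simp [hK]
  have hmul : N.det • (N * Matrix.of K) = N.det • 1 := by
    rw [← Matrix.mul_smul, ← hadj, Matrix.mul_adjugate]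
  exact Matrix.isUnit_det_of_right_inverse (smul_right_injective _ h0 hmul)

-- The kernel of `N` modulo `p` is at most one-dimensional: some entry `(i, j)` of the adjugate is
-- not divisible by `p`, and it is the determinant of `N` with row `j` replaced by `eᵢ`.
theorem exists_index_forall_dvd [IsDomain R] {p : R} (hp : Prime p) {N : Matrix κ κ R}
    (hN : Associated N.det p) :
    ∃ i, ∀ x : κ → R, (∀ k, p ∣ (N *ᵥ x) k) → p ∣ x i → ∀ j, p ∣ x j := by
  obtain ⟨i, j, hij⟩ : ∃ i j, ¬p ∣ N.adjugate i j := by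
    by_contra! h
    have hunit := isUnit_det_of_det_dvd_adjugate (hN.ne_zero_iff.2 hp.ne_zero)
      fun i j => hN.dvd.trans (h i j)
    exact hp.not_isUnit (hN.isUnit hunit)
  refine ⟨i, fun x hNx hxi => ?_⟩
  by_contra! hx
  rw [Matrix.adjugate_apply] at hij
  refine hij (dvd_det_of_dvd_mulVec hp _ (fun k => ?_) hx)
  obtain rfl | hk := eq_or_ne k j
  · simpa [Matrix.mulVec] using hxi
  · simpa [Matrix.mulVec, Matrix.updateRow_ne hk] using hNx k

theorem forall_even_or_forall_even_sub {N : Matrix κ κ ℤ} (hN : N.det.natAbs = 2) {x d : κ → ℤ}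
    (hNx : ∀ k, 2 ∣ (N *ᵥ x) k) (hNd : ∀ k, 2 ∣ (N *ᵥ d) k) (hd : ∃ j, ¬2 ∣ d j) :
    (∀ j, 2 ∣ x j) ∨ ∀ j, 2 ∣ d j - x j := by
  obtain ⟨i, hi⟩ := exists_index_forall_dvd Int.prime_two (Int.associated_iff_natAbs.2 hN)
  have hdi : ¬2 ∣ d i := fun h => hd.elim fun j hj => hj (hi d hNd h j)
  refine (em (2 ∣ x i)).imp (hi x hNx) fun hxi => hi (d - x) (fun k => ?_) ?_
  · rw [Matrix.mulVec_sub]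
    exact dvd_sub (hNd k) (hNx k)
  · rw [Pi.sub_apply]
    omega

end Divisibility

section SpanningRows

variable {ι κ K : Type*} [Fintype κ]

/-- The rows of `M` indexed by `S` span the space of all row vectors. This is encoded dually: the
only vector orthogonal to all of these rows is zero. -/
def SpanningRows [Field K] (M : Matrix ι κ K) (S : Set ι) : Prop :=
  ∀ u : κ → K, (∀ i ∈ S, (M *ᵥ u) i = 0) → u = 0

theorem SpanningRows.mono [Field K] {M : Matrix ι κ K} {S T : Set ι} (hST : S ⊆ T)
    (h : SpanningRows M S) : SpanningRows M T :=
  fun u hu => h u fun i hi => hu i (hST hi)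

theorem SpanningRows.span_eq_top [Field K] {M : Matrix ι κ K} {S : Set ι} (h : SpanningRows M S) :
    Submodule.span K (Set.range fun i : S => M i) = ⊤ := by
  classical
  by_contra hne
  obtain ⟨f, hf, hle⟩ := Submodule.exists_le_ker_of_lt_top _ (lt_top_iff_ne_top.2 hne)
  obtain ⟨u, rfl⟩ := (dotProductEquiv K κ).surjective f
  have hu : u = 0 := h u fun i hi => by
    have hi' : u ⬝ᵥ M i = 0 := hle (Submodule.subset_span ⟨⟨i, hi⟩, rfl⟩)
    rwa [dotProduct_comm] at hi'
  exact hf (by rw [hu, map_zero])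

theorem SpanningRows.exists_det_ne_zero [Field K] [DecidableEq κ] {M : Matrix ι κ K}
    {S : Set ι} (h : SpanningRows M S) :
    ∃ r : κ → ι, (∀ k, r k ∈ S) ∧ (M.submatrix r id).det ≠ 0 := by
  obtain ⟨τ, a, -, hspan, hli⟩ := exists_linearIndependent' K fun i : S => M i
  rw [h.span_eq_top] at hspan
  let e : κ ≃ τ := (Pi.basisFun K κ).indexEquiv (Module.Basis.mk hli hspan.ge)
  refine ⟨fun k => a (e k), fun k => (a (e k)).2, ?_⟩
  have hrows : LinearIndependent K (M.submatrix (fun k => (a (e k) : ι)) id).row :=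
    hli.comp e e.injective
  rw [Matrix.linearIndependent_rows_iff_isUnit, Matrix.isUnit_iff_isUnit_det] at hrows
  exact hrows.ne_zero

end SpanningRows

section Conformal

variable {ι κ K : Type*} [Field K] [LinearOrder K] [IsStrictOrderedRing K]

/-- `x` is conformal to `y`: each entry of `x` is zero or has the same sign as the corresponding
entry of `y`. -/
def IsConformal {ι R : Type*} [Zero R] [Mul R] [LE R] (x y : ι → R) : Prop :=
  ∀ i, 0 ≤ x i * y i ∧ (y i = 0 → x i = 0)

theorem IsConformal.refl (x : ι → K) : IsConformal x x :=
  fun _ => ⟨mul_self_nonneg _, id⟩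

theorem IsConformal.trans {x y z : ι → K} (hxy : IsConformal x y) (hyz : IsConformal y z) :
    IsConformal x z := by
  refine fun i => ⟨?_, fun h => (hxy i).2 ((hyz i).2 h)⟩
  obtain hy | hy := eq_or_ne (y i) 0
  · rw [(hxy i).2 hy, zero_mul]
  · have h : 0 ≤ x i * z i * (y i * y i) := by
      linarith [mul_nonneg (hxy i).1 (hyz i).1]
    exact nonneg_of_mul_nonneg_left h (mul_self_pos.2 hy)

-- Subtract `t • u`, where `|t|` is the least ratio `|x i / u i|`.
theorem exists_isConformal_sub_smul [Finite ι] {x u : ι → K} (hu : u ≠ 0)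
    (hux : u.support ⊆ x.support) :
    ∃ t : K, IsConformal (x - t • u) x ∧ (x - t • u).support ⊂ x.support := by
  obtain ⟨i, hi, hmin⟩ := u.support.toFinite.exists_minimalFor (fun i => |x i / u i|) _
    (Function.support_nonempty_iff.2 hu)
  refine ⟨x i / u i, ?_⟩
  have hle : ∀ k, |x i / u i * u k| ≤ |x k| := fun k => by
    obtain hk | hk := eq_or_ne (u k) 0
    · simp [hk]
    · have hik : |x i / u i| ≤ |x k / u k| := (le_total _ _).elim id fun h => hmin hk h
      rwa [abs_div (x k), le_div_iff₀ (abs_pos.2 hk), ← abs_mul] at hik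
  have hconf : IsConformal (x - (x i / u i) • u) x := fun k => by
    refine ⟨?_, fun hk => ?_⟩
    · have h : x i / u i * u k * x k ≤ x k * x k :=
        (le_abs_self _).trans (by
          rw [abs_mul, ← abs_mul_abs_self (x k)]
          exact mul_le_mul_of_nonneg_right (hle k) (abs_nonneg _))
      simpa [sub_mul] using h
    · have huk : u k = 0 := by_contra fun h => hux h hk
      simp [hk, huk]
  refine ⟨hconf, fun k hk hxk => hk ((hconf k).2 hxk), fun h => h (hux hi) ?_⟩
  simp [div_mul_cancel₀ _ (Function.mem_support.1 hi)]

theorem exists_elementary_isConformal [Finite ι] (W : Submodule K (ι → K)) {d : ι → K}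
    (hdW : d ∈ W) (hd : d ≠ 0) :
    ∃ x ∈ W, x ≠ 0 ∧ IsConformal x d ∧ ∀ u ∈ W, u.support ⊆ x.support → ∃ t : K, u = t • x := by
  obtain ⟨x, ⟨hxW, hx, hxd⟩, hmin⟩ := exists_minimalFor_of_wellFoundedLT
    (fun x : ι → K => x ∈ W ∧ x ≠ 0 ∧ IsConformal x d) Function.support
    ⟨d, hdW, hd, IsConformal.refl d⟩
  refine ⟨x, hxW, hx, hxd, fun u huW hux => ?_⟩
  obtain rfl | hu := eq_or_ne u 0
  · exact ⟨0, (zero_smul K x).symm⟩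
  obtain ⟨t, hconf, hsupp⟩ := exists_isConformal_sub_smul hu hux
  have hxt : x - t • u = 0 := by
    by_contra hne
    exact hsupp.2 (hmin ⟨W.sub_mem hxW (W.smul_mem t huW), hne, hconf.trans hxd⟩ hsupp.1)
  have ht : t ≠ 0 := by
    rintro rfl
    exact hx (by simpa using hxt)
  exact ⟨t⁻¹, by rw [sub_eq_zero.1 hxt, inv_smul_smul₀ ht]⟩

end Conformal

section Cramer

variable {ι κ : Type*} [Fintype κ] [DecidableEq κ]

theorem mulVec_adjugate_col {R : Type*} [CommRing R] (M : Matrix ι κ R) (r : κ → ι) (k : κ)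
    (i : ι) :
    (M *ᵥ (M.submatrix r id).adjugate.col k) i = (M.submatrix (Function.update r k i) id).det := by
  have hupdate : M.submatrix (Function.update r k i) id = (M.submatrix r id).updateRow k (M i) := by
    ext l j
    obtain rfl | hl := eq_or_ne l k <;> simp [*]
  rw [hupdate, Matrix.det_eq_sum_mul_adjugate_row _ k]
  simp [Matrix.mulVec, dotProduct, Matrix.adjugate_apply]

theorem eq_smul_adjugate_col_of_mulVec_eq_single {K : Type*} [Field K] {N : Matrix κ κ K}
    (hN : N.det ≠ 0) {x : κ → K} {k : κ} {a : K} (hx : N *ᵥ x = Pi.single k a) :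
    x = (a / N.det) • N.adjugate.col k := by
  have h : N.det • x = a • N.adjugate.col k := by
    have := congrArg (N.adjugate *ᵥ ·) hx
    simpa only [Matrix.mulVec_mulVec, Matrix.adjugate_mul, Matrix.smul_mulVec, Matrix.one_mulVec,
      Matrix.mulVec_single, op_smul_eq_smul] using this
  rw [div_eq_inv_mul, mul_smul, ← h, inv_smul_smul₀ hN]

end Cramer

section Elementary

variable {ι κ K : Type*} [Fintype κ] [Field K] [LinearOrder K] [IsStrictOrderedRing K] [Finite ι]
  {M : Matrix ι κ K} {S : Set ι} {d : κ → K}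

theorem SpanningRows.exists_isConformal_spanningRows_insert (h : SpanningRows M S) (hd : d ≠ 0) :
    ∃ (x : κ → K) (i₀ : ι), i₀ ∈ S ∧ (M *ᵥ x) i₀ ≠ 0 ∧
      IsConformal (S.domRestrict (M *ᵥ x)) (S.domRestrict (M *ᵥ d)) ∧
      SpanningRows M (insert i₀ {i ∈ S | (M *ᵥ x) i = 0}) := by
  let φ : (κ → K) →ₗ[K] (S → K) := (M.submatrix Subtype.val id).mulVecLin
  have hφ0 : ∀ u, φ u = 0 → u = 0 := fun u hu => h u fun i hi => congrFun hu ⟨i, hi⟩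
  obtain ⟨_, ⟨x, rfl⟩, hx, hxd, hmin⟩ :=
    exists_elementary_isConformal (LinearMap.range φ) ⟨d, rfl⟩ fun h0 => hd (hφ0 d h0)
  obtain ⟨⟨i₀, hi₀⟩, hxi₀ : (M *ᵥ x) i₀ ≠ 0⟩ := Function.ne_iff.1 hx
  refine ⟨x, i₀, hi₀, hxi₀, hxd, fun u hu => ?_⟩
  obtain ⟨t, ht⟩ := hmin (φ u) ⟨u, rfl⟩ fun i hui hxi => hui (hu i (Or.inr ⟨i.2, hxi⟩))
  have hti₀ : (M *ᵥ u) i₀ = t * (M *ᵥ x) i₀ := congrFun ht ⟨i₀, hi₀⟩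
  have ht0 : t = 0 :=
    (mul_eq_zero.1 (hti₀.symm.trans (hu i₀ (Or.inl rfl)))).resolve_right hxi₀
  exact hφ0 u (by rw [ht, ht0, zero_smul])

variable [DecidableEq κ]

-- The rows in `S` where an elementary vector `x` vanishes, together with one row where it does not,
-- contain a nonsingular `N`; since `N x` has a single nonzero entry, Cramer's rule gives `x`.
theorem SpanningRows.exists_isConformal_smul_adjugate_col (h : SpanningRows M S) (hd : d ≠ 0) :
    ∃ (r : κ → ι) (k : κ) (t : K), (∀ l, r l ∈ S) ∧ (M.submatrix r id).det ≠ 0 ∧ t ≠ 0 ∧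
      IsConformal (S.domRestrict (M *ᵥ (t • (M.submatrix r id).adjugate.col k)))
        (S.domRestrict (M *ᵥ d)) := by
  obtain ⟨x, i₀, hi₀, hxi₀, hxd, hspan⟩ := h.exists_isConformal_spanningRows_insert hd
  obtain ⟨r, hr, hdet⟩ := hspan.exists_det_ne_zero
  have hrS : ∀ l, r l ∈ S := fun l => (hr l).elim (fun hl => hl ▸ hi₀) And.left
  obtain ⟨k, hk⟩ : ∃ k, (M *ᵥ x) (r k) ≠ 0 := by
    by_contra! h0
    have hx0 : x = 0 := Matrix.eq_zero_of_mulVec_eq_zero hdet (funext h0)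
    simp [hx0] at hxi₀
  have hrk : r k = i₀ := (hr k).resolve_right fun h => hk h.2
  have hNx : M.submatrix r id *ᵥ x = Pi.single k ((M *ᵥ x) (r k)) := by
    ext l
    obtain rfl | hl := eq_or_ne l k
    · rw [Pi.single_eq_same]
      rfl
    · rw [Pi.single_eq_of_ne hl]
      have hrl : r l ≠ r k := fun heq =>
        hdet (Matrix.det_zero_of_row_eq hl (by ext j; simp [heq]))
      exact ((hr l).resolve_left fun h => hrl (h.trans hrk.symm)).2
  refine ⟨r, k, _, hrS, hdet, div_ne_zero hk hdet, ?_⟩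
  rwa [← eq_smul_adjugate_col_of_mulVec_eq_single hdet hNx]

end Elementary

section ConformalInt

theorem sum_natAbs_sub_lt {ι : Type*} {s : Finset ι} {x y : ι → ℤ}
    (hxy : ∀ i ∈ s, x i ∈ Set.uIcc 0 (y i)) (hx : ∃ i ∈ s, x i ≠ 0) :
    ∑ i ∈ s, (y i - x i).natAbs < ∑ i ∈ s, (y i).natAbs := by
  have hle : ∀ i ∈ s, (y i - x i).natAbs ≤ (y i).natAbs ∧
      (x i ≠ 0 → (y i - x i).natAbs < (y i).natAbs) := fun i hi => by
    have := Set.mem_uIcc.1 (hxy i hi)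
    omega
  obtain ⟨i, hi, hxi⟩ := hx
  exact Finset.sum_lt_sum (fun i hi => (hle i hi).1) ⟨i, hi, (hle i hi).2 hxi⟩

variable {ι κ : Type*} [Fintype κ]

theorem map_intCast_mulVec (M : Matrix ι κ ℤ) (x : κ → ℤ) (i : ι) :
    (M.map (Int.cast : ℤ → ℝ) *ᵥ fun j => (x j : ℝ)) i = ((M *ᵥ x) i : ℤ) :=
  (RingHom.map_mulVec (Int.castRingHom ℝ) M x i).symm

variable [DecidableEq κ] [Finite ι] {M : Matrix ι κ ℤ} {S : Set ι} {d : κ → ℤ}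

theorem SpanningRows.exists_isConformal_natAbs_eq_natAbs_det
    (h : SpanningRows (M.map (Int.cast : ℤ → ℝ)) S) (hd : d ≠ 0) :
    ∃ (x : κ → ℤ) (r : κ → ι) (k : κ), (∀ l, r l ∈ S) ∧ (M.submatrix r id).det ≠ 0 ∧
      (∀ i, ((M *ᵥ x) i).natAbs = (M.submatrix (Function.update r k i) id).det.natAbs) ∧
      IsConformal (S.domRestrict (M *ᵥ x)) (S.domRestrict (M *ᵥ d)) := by
  have hdR : (fun j => (d j : ℝ)) ≠ 0 := fun h0 => hd (funext fun j => by
    simpa using congrFun h0 j)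
  obtain ⟨r, k, t, hrS, hdet, ht, hconf⟩ := h.exists_isConformal_smul_adjugate_col hdR
  set c := (M.submatrix r id).adjugate.col k with hc
  have hcR : ((M.map (Int.cast : ℤ → ℝ)).submatrix r id).adjugate.col k = fun j => (c j : ℝ) := by
    ext j
    exact congrFun₂ (RingHom.map_adjugate (Int.castRingHom ℝ) (M.submatrix r id)).symm j k
  obtain ⟨ε, hε, hεt⟩ : ∃ ε : ℤ, ε.natAbs = 1 ∧ 0 < t * ε := by
    obtain ht | ht := ht.lt_or_gt
    · exact ⟨-1, rfl, by push_cast; linarith⟩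
    · exact ⟨1, rfl, by push_cast; linarith⟩
  have hdetR : ((M.map (Int.cast : ℤ → ℝ)).submatrix r id).det = (M.submatrix r id).det :=
    (RingHom.map_det (Int.castRingHom ℝ) (M.submatrix r id)).symm
  rw [hdetR, Int.cast_ne_zero] at hdet
  refine ⟨ε • c, r, k, hrS, hdet, fun i => ?_, fun i => ?_⟩
  · rw [Matrix.mulVec_smul, Pi.smul_apply, smul_eq_mul, Int.natAbs_mul, hε, one_mul, hc,
      mulVec_adjugate_col]
  · obtain ⟨hpos, hzero⟩ := hconf i
    simp only [Set.domRestrict_apply, hcR, Matrix.mulVec_smul, Pi.smul_apply, smul_eq_mul,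
      map_intCast_mulVec] at hpos hzero ⊢
    have hε2 : (ε : ℝ) * ε = 1 := by
      exact_mod_cast (Int.natAbs_mul_self' ε).symm.trans (by rw [hε]; rfl)
    refine ⟨?_, fun h0 => ?_⟩
    · have : (0 : ℝ) ≤ t * ε * (ε * (M *ᵥ c) i * (M *ᵥ d) i) := by
        linear_combination hpos - t * (M *ᵥ c) i * (M *ᵥ d) i * hε2
      exact_mod_cast nonneg_of_mul_nonneg_right this hεt
    · have hci := (mul_eq_zero.1 (hzero (by exact_mod_cast h0))).resolve_left ht
      rw [Int.cast_eq_zero.1 hci, mul_zero]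

theorem SpanningRows.exists_even_or_even_sub (h : SpanningRows (M.map (Int.cast : ℤ → ℝ)) S)
    (hM : ∀ r : κ → ι, (M.submatrix r id).det.natAbs ≤ 2) (hMd : ∀ i ∈ S, 2 ∣ (M *ᵥ d) i)
    (hd : ∃ j, ¬2 ∣ d j) :
    ∃ x : κ → ℤ, (∃ i ∈ S, (M *ᵥ x) i ≠ 0) ∧ (∀ i, |(M *ᵥ x) i| ≤ 2) ∧
      (∀ i ∈ S, (M *ᵥ x) i ∈ Set.uIcc 0 ((M *ᵥ d) i)) ∧
      ((∀ j, 2 ∣ x j) ∨ ∀ j, 2 ∣ d j - x j) := by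
  have hd0 : d ≠ 0 := by
    rintro rfl
    simp at hd
  obtain ⟨x, r, k, hrS, hdet, hx, hconf⟩ := h.exists_isConformal_natAbs_eq_natAbs_det hd0
  have heven : ∀ r : κ → ι, (∀ l, r l ∈ S) → 2 ∣ (M.submatrix r id).det := fun r hr =>
    dvd_det_of_dvd_mulVec Int.prime_two _ (fun l => hMd (r l) (hr l)) hd
  have hMx : ∀ i ∈ S, 2 ∣ (M *ᵥ x) i := fun i hi => by
    have := heven (Function.update r k i) fun l => by
      obtain rfl | hl := eq_or_ne l k <;> simp [*]
    rwa [← Int.natAbs_dvd_natAbs, hx, Int.natAbs_dvd_natAbs]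
  have hx2 : ∀ i, |(M *ᵥ x) i| ≤ 2 := fun i => by
    rw [Int.abs_eq_natAbs, hx]
    exact_mod_cast hM _
  refine ⟨x, ⟨r k, hrS k, ?_⟩, hx2, fun i hi => ?_, ?_⟩
  · rwa [← Int.natAbs_ne_zero, hx, Function.update_eq_self, Int.natAbs_ne_zero]
  · obtain ⟨hpos, hzero⟩ := hconf ⟨i, hi⟩
    simp only [Set.domRestrict_apply] at hpos hzero
    have := hMx i hi
    have := hMd i hi
    have := abs_le.1 (hx2 i)
    rw [Set.mem_uIcc]
    obtain h | h := mul_nonneg_iff.1 hpos <;> omega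
  · have hdet2 : (M.submatrix r id).det.natAbs = 2 := by
      have := heven r hrS
      have := hM r
      omega
    exact forall_even_or_forall_even_sub hdet2 (fun l => hMx _ (hrS l)) (fun l => hMd _ (hrS l)) hd

-- Subtract even elementary vectors conformal to `d` as long as there are any: the next elementary
-- vector is then congruent to `d` modulo two.
theorem SpanningRows.exists_even_sub_mem_uIcc (h : SpanningRows (M.map (Int.cast : ℤ → ℝ)) S)
    (hM : ∀ r : κ → ι, (M.submatrix r id).det.natAbs ≤ 2) (hMd : ∀ i ∈ S, 2 ∣ (M *ᵥ d) i)
    (hd : ∃ j, ¬2 ∣ d j) :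
    ∃ g : κ → ℤ, (∀ j, 2 ∣ d j - g j) ∧ (∀ i, |(M *ᵥ g) i| ≤ 2) ∧
      ∀ i ∈ S, (M *ᵥ g) i ∈ Set.uIcc 0 ((M *ᵥ d) i) := by
  classical
  have := Fintype.ofFinite ι
  obtain ⟨e, ⟨hde, heS⟩, hmin⟩ := exists_minimalFor_of_wellFoundedLT
    (fun e : κ → ℤ => (∀ j, 2 ∣ d j - e j) ∧ ∀ i ∈ S, (M *ᵥ e) i ∈ Set.uIcc 0 ((M *ᵥ d) i))
    (fun e => ∑ i with i ∈ S, ((M *ᵥ e) i).natAbs) ⟨d, by simp⟩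
  have hMe : ∀ i ∈ S, 2 ∣ (M *ᵥ e) i := fun i hi => by
    have hsub : 2 ∣ (M *ᵥ (d - e)) i := dvd_mulVec M hde i
    rw [Matrix.mulVec_sub, Pi.sub_apply] at hsub
    exact (dvd_sub_right (hMd i hi)).1 hsub
  have he : ∃ j, ¬2 ∣ e j := hd.imp fun j hj hej => hj ((dvd_sub_left hej).1 (hde j))
  obtain ⟨x, ⟨i₀, hi₀, hxi₀⟩, hx2, hxS, hx | hx⟩ := h.exists_even_or_even_sub hM hMe he
  · have hMex : ∀ i ∈ S, (M *ᵥ (e - x)) i ∈ Set.uIcc 0 ((M *ᵥ e) i) := fun i hi => by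
      have := hxS i hi
      rw [Matrix.mulVec_sub, Pi.sub_apply]
      rw [Set.mem_uIcc] at this ⊢
      omega
    have hlt := sum_natAbs_sub_lt (s := {i | i ∈ S}) (x := M *ᵥ x) (y := M *ᵥ e)
      (fun i hi => hxS i (by simpa using hi)) ⟨i₀, by simpa using hi₀, hxi₀⟩
    simp only [← Pi.sub_apply, ← Matrix.mulVec_sub] at hlt
    refine absurd (hmin ⟨fun j => ?_, fun i hi => ?_⟩ hlt.le) hlt.not_ge
    · rw [Pi.sub_apply, sub_sub_eq_add_sub, add_sub_right_comm]
      exact dvd_add (hde j) (hx j)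
    · exact Set.uIcc_subset_uIcc_left (heS i hi) (hMex i hi)
  · exact ⟨x, fun j => by simpa using dvd_add (hde j) (hx j), hx2, fun i hi =>
      Set.uIcc_subset_uIcc_left (heS i hi) (hxS i hi)⟩

end ConformalInt

section Minors

theorem det_submatrix_eq_zero_of_not_injective_left {ι κ α R : Type*} [CommRing R] [Fintype α]
    [DecidableEq α] (A : Matrix ι κ R) {r : α → ι} (s : α → κ) (hr : ¬r.Injective) :
    (A.submatrix r s).det = 0 := by
  obtain ⟨i, j, hij, hne⟩ := Function.not_injective_iff.1 hr
  exact Matrix.det_zero_of_row_eq hne (by ext l; simp [hij])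

theorem det_submatrix_eq_zero_of_not_injective_right {ι κ α R : Type*} [CommRing R] [Fintype α]
    [DecidableEq α] (A : Matrix ι κ R) (r : α → ι) {s : α → κ} (hs : ¬s.Injective) :
    (A.submatrix r s).det = 0 := by
  rw [← Matrix.det_transpose, Matrix.transpose_submatrix]
  exact det_submatrix_eq_zero_of_not_injective_left _ r hs

/-- The matrix `A` stacked on top of the identity matrix. Its rows are the constraint normals of a
polyhedron `A x ≤ b` together with the coordinate functionals. -/
abbrev withUnitRows {ι κ R : Type*} [DecidableEq κ] [Zero R] [One R] (A : Matrix ι κ R) :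
    Matrix (ι ⊕ κ) κ R :=
  Matrix.fromRows A 1

theorem natAbs_det_submatrix_withUnitRows_le {ι κ : Type*} [DecidableEq κ] {A : Matrix ι κ ℤ}
    {d : ℕ} (hA : ∀ (k : ℕ) (r : Fin k → ι) (s : Fin k → κ), (A.submatrix r s).det.natAbs ≤ d)
    (k : ℕ) (r : Fin k → ι ⊕ κ) (s : Fin k → κ) :
    ((withUnitRows A).submatrix r s).det.natAbs ≤ d := by
  by_cases hr : ∃ i j, r i = Sum.inr j
  · obtain ⟨i, j, hij⟩ := hr
    cases k with
    | zero => exact i.elim0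
    | succ k =>
      by_cases hs : s.Injective
      · by_cases hj : ∃ l, s l = j
        · obtain ⟨l, rfl⟩ := hj
          have hl : ∀ l' ≠ l, (1 : Matrix κ κ ℤ) (s l) (s l') = 0 := fun l' hl' =>
            Matrix.one_apply_ne (hs.ne hl'.symm)
          rw [Matrix.det_succ_row _ i, Finset.sum_eq_single l (fun l' _ hl' => by
            simp [hij, hl l' hl']) (by simp)]
          simpa [hij, Int.natAbs_mul, Int.natAbs_pow] using
            natAbs_det_submatrix_withUnitRows_le hA k _ _
        · push Not at hj
          rw [Matrix.det_eq_zero_of_row_eq_zero i fun l => by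
            simp [hij, Matrix.one_apply_ne (hj l).symm]]
          simp
      · rw [det_submatrix_eq_zero_of_not_injective_right _ r hs]
        simp
  · push Not at hr
    have hinl : ∀ i, ∃ a, r i = Sum.inl a := fun i => by
      cases h : r i with
      | inl a => exact ⟨a, rfl⟩
      | inr j => exact absurd h (hr i j)
    choose r' hr' using hinl
    obtain rfl : r = Sum.inl ∘ r' := funext hr'
    exact hA k r' s

variable {m n : ℕ} {A : Matrix (Fin m) (Fin n) ℤ}

theorem natAbs_det_submatrix_le_maxSubdet (hA : 1 ≤ maxSubdet A) (k : ℕ) (r : Fin k → Fin m)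
    (s : Fin k → Fin n) : (A.submatrix r s).det.natAbs ≤ maxSubdet A := by
  obtain rfl | hk := k.eq_zero_or_pos
  · simpa using hA
  by_cases hr : r.Injective
  · by_cases hs : s.Injective
    · have hkm : k ≤ m := by simpa using Fintype.card_le_of_injective r hr
      have hkn : k ≤ n := by simpa using Fintype.card_le_of_injective s hs
      refine Finset.le_sup_of_le (Finset.mem_Icc.2 ⟨hk, le_min hkm hkn⟩) ?_
      refine Finset.le_sup_of_le (Finset.mem_univ ⟨r, hr⟩) ?_
      exact Finset.le_sup_of_le (Finset.mem_univ ⟨s, hs⟩) le_rfl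
    · simp [det_submatrix_eq_zero_of_not_injective_right _ r hs]
  · simp [det_submatrix_eq_zero_of_not_injective_left _ s hr]

end Minors

section Polyhedron

variable {ι κ : Type*} [Fintype κ] [Finite ι] {M : Matrix ι κ ℝ} {h : ι → ℝ} {v u : κ → ℝ}

theorem eventually_mulVec_add_smul_le (hv : M *ᵥ v ≤ h)
    (hu : ∀ i, (M *ᵥ v) i = h i → (M *ᵥ u) i ≤ 0) :
    ∀ᶠ ε : ℝ in 𝓝[>] 0, M *ᵥ (v + ε • u) ≤ h := by
  simp only [Pi.le_def, Filter.eventually_all, Matrix.mulVec_add, Matrix.mulVec_smul, Pi.add_apply,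
    Pi.smul_apply, smul_eq_mul]
  intro i
  obtain hi | hi := (hv i).eq_or_lt
  · filter_upwards [self_mem_nhdsWithin] with ε hε
    linarith [mul_nonpos_of_nonneg_of_nonpos (le_of_lt hε) (hu i hi)]
  · have hcont : Continuous fun ε : ℝ => (M *ᵥ v) i + ε * (M *ᵥ u) i := by fun_prop
    have hlim := (hcont.tendsto 0).mono_left (nhdsWithin_le_nhds (s := Set.Ioi 0))
    exact (hlim.eventually_lt_const (by simpa using hi)).mono fun _ => le_of_lt

theorem spanningRows_of_mem_extremePoints (hv : v ∈ {x | M *ᵥ x ≤ h}.extremePoints ℝ) :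
    SpanningRows M {i | (M *ᵥ v) i = h i} := by
  intro u hu
  have hneg : ∀ i, (M *ᵥ v) i = h i → (M *ᵥ -u) i ≤ 0 := fun i hi => by
    simp [Matrix.mulVec_neg, hu i hi]
  obtain ⟨ε, ⟨hadd, hsub⟩, hε⟩ := ((eventually_mulVec_add_smul_le hv.1 fun i hi => (hu i hi).le).and
    (eventually_mulVec_add_smul_le hv.1 hneg)).and self_mem_nhdsWithin |>.exists
  have hmid : v ∈ openSegment ℝ (v + ε • u) (v + ε • -u) :=
    ⟨1 / 2, 1 / 2, by norm_num, by norm_num, by norm_num, by module⟩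
  have hεu : ε • u = 0 := by simpa using hv.2 hadd hsub hmid
  exact (smul_eq_zero.1 hεu).resolve_left (ne_of_gt hε)

theorem exists_spanningRows_eq_or_eq (hM : Function.Injective M.mulVec) {l h : ι → ℝ} {w : κ → ℝ}
    (hw : M *ᵥ w ∈ Set.Icc l h) :
    ∃ v, M *ᵥ v ∈ Set.Icc l h ∧ SpanningRows M {i | (M *ᵥ v) i = l i ∨ (M *ᵥ v) i = h i} := by
  have hbox : M.mulVecLin ⁻¹' Set.Icc l h =
      {x | Matrix.fromRows M (-M) *ᵥ x ≤ Sum.elim h (-l)} := by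
    ext x
    simp [Matrix.fromRows_mulVec, Matrix.neg_mulVec, and_comm]
  have hcompact : IsCompact (M.mulVecLin ⁻¹' Set.Icc l h) :=
    (LinearMap.isClosedEmbedding_of_injective
      (LinearMap.ker_eq_bot.2 hM)).isCompact_preimage isCompact_Icc
  obtain ⟨v, hv⟩ := hcompact.extremePoints_nonempty ⟨w, hw⟩
  refine ⟨v, hv.1, fun u hu => ?_⟩
  rw [hbox] at hv
  refine spanningRows_of_mem_extremePoints hv u fun i hi => ?_
  cases i with
  | inl i => simpa [Matrix.fromRows_mulVec] using hu i (Or.inr (by simpa using hi))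
  | inr i =>
    simpa [Matrix.fromRows_mulVec, Matrix.neg_mulVec] using
      hu i (Or.inl (by simpa [Matrix.fromRows_mulVec, Matrix.neg_mulVec] using hi))

theorem exists_floor_le_mulVec_le_ceil (hM : Function.Injective M.mulVec) (w : κ → ℝ) :
    ∃ v, (∀ i, ⌊(M *ᵥ w) i⌋ ≤ (M *ᵥ v) i ∧ (M *ᵥ v) i ≤ ⌈(M *ᵥ w) i⌉) ∧
      SpanningRows M {i | ∃ k : ℤ, (M *ᵥ v) i = k} := by
  obtain ⟨v, ⟨hfloor, hceil⟩, hspan⟩ := exists_spanningRows_eq_or_eq hM (w := w)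
    (l := fun i => ⌊(M *ᵥ w) i⌋) (h := fun i => ⌈(M *ᵥ w) i⌉)
    ⟨fun i => Int.floor_le _, fun i => Int.le_ceil _⟩
  exact ⟨v, fun i => ⟨hfloor i, hceil i⟩, hspan.mono fun i hi => hi.elim
    (fun h => ⟨_, h⟩) fun h => ⟨_, h⟩⟩

end Polyhedron

section Rounding

theorem abs_sub_le_one_of_floor_le_of_le_ceil {s t : ℝ} (h₁ : ⌊s⌋ ≤ t) (h₂ : t ≤ ⌈s⌉) :
    |s - t| ≤ 1 := by
  have h : (⌈s⌉ : ℝ) ≤ ⌊s⌋ + 1 := by exact_mod_cast Int.ceil_le_floor_add_one s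
  rw [abs_le]
  constructor <;> linarith [Int.floor_le s, Int.le_ceil s]

theorem SpanningRows.exists_mul_eq_intCast {ι κ : Type*} [Fintype κ] [DecidableEq κ]
    {M : Matrix ι κ ℤ} {v : κ → ℝ} {d : ℕ}
    (h : SpanningRows (M.map (Int.cast : ℤ → ℝ))
      {i | ∃ k : ℤ, (M.map (Int.cast : ℤ → ℝ) *ᵥ v) i = k})
    (hM : ∀ r : κ → ι, (M.submatrix r id).det.natAbs ≤ d) :
    ∃ q : ℕ, 1 ≤ q ∧ q ≤ d ∧ ∃ x : κ → ℤ, ∀ j, (q : ℝ) * v j = x j := by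
  obtain ⟨r, hr, hdet⟩ := h.exists_det_ne_zero
  choose β hβ using hr
  set N := M.submatrix r id with hN
  have hdetR : ((M.map (Int.cast : ℤ → ℝ)).submatrix r id).det = N.det :=
    (RingHom.map_det (Int.castRingHom ℝ) N).symm
  rw [hdetR, Int.cast_ne_zero] at hdet
  have hcramer : ∀ j, (N.det : ℝ) * v j = ((N.adjugate *ᵥ β) j : ℤ) := fun j => by
    have hNv : (N.map (Int.cast : ℤ → ℝ)) *ᵥ v = fun k => (β k : ℝ) := funext hβ
    have hadj : N.adjugate.map (Int.cast : ℤ → ℝ) = (N.map (Int.cast : ℤ → ℝ)).adjugate :=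
      RingHom.map_adjugate (Int.castRingHom ℝ) N
    rw [← map_intCast_mulVec, ← hNv, hadj, Matrix.mulVec_mulVec, Matrix.adjugate_mul,
      Matrix.smul_mulVec, Matrix.one_mulVec, ← hdetR]
    rfl
  refine ⟨N.det.natAbs, Int.natAbs_pos.2 hdet, hM r, N.det.sign • (N.adjugate *ᵥ β), fun j => ?_⟩
  have habs : (N.det.natAbs : ℝ) = N.det.sign * N.det := by
    rw [Nat.cast_natAbs, ← Int.sign_mul_self_eq_abs, Int.cast_mul]
  rw [habs, mul_assoc, hcramer, Pi.smul_apply, smul_eq_mul, Int.cast_mul]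

variable {ι κ : Type*} [Fintype κ] [DecidableEq κ]

theorem map_withUnitRows_mulVec (A : Matrix ι κ ℤ) (x : κ → ℝ) :
    (withUnitRows A).map (Int.cast : ℤ → ℝ) *ᵥ x =
      Sum.elim (A.map (Int.cast : ℤ → ℝ) *ᵥ x) x := by
  simp [Matrix.fromRows_map, Matrix.fromRows_mulVec]

variable [Finite ι] {A : Matrix ι κ ℤ} {b : ι → ℤ}
  {y : κ → ℤ}

-- A conformal part `g` of the even difference `2 * y - x`, congruent to it modulo two, leads from
-- `x / 2` to the integral vector `(x + g) / 2`.
theorem exists_int_near_half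
    (hM : ∀ r : κ → ι ⊕ κ, ((withUnitRows A).submatrix r id).det.natAbs ≤ 2) {x : κ → ℤ}
    (hspan : SpanningRows ((withUnitRows A).map (Int.cast : ℤ → ℝ))
      {i | 2 ∣ (withUnitRows A *ᵥ x) i})
    (hx : ∃ j, ¬2 ∣ x j) (hxb : ∀ i, (A *ᵥ x) i ≤ 2 * b i) (hyb : ∀ i, (A *ᵥ y) i ≤ b i) :
    ∃ z : κ → ℤ, (∀ i, (A *ᵥ z) i ≤ b i) ∧ (∀ j, |x j - 2 * z j| ≤ 2) ∧
      ∀ i, (A *ᵥ x) i = 2 * b i → (A *ᵥ y) i ≤ (A *ᵥ z) i := by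
  have hd : ∃ j, ¬2 ∣ ((2 : ℤ) • y - x) j := hx.imp fun j hj => by
    simp only [Pi.sub_apply, Pi.smul_apply, smul_eq_mul]
    omega
  obtain ⟨g, hg, hg2, hgS⟩ := hspan.exists_even_sub_mem_uIcc hM (fun i hi => by
    rw [Matrix.mulVec_sub, Matrix.mulVec_smul]
    exact dvd_sub (dvd_mul_right 2 _) hi) hd
  simp only [Matrix.fromRows_mulVec, Matrix.one_mulVec, Matrix.mulVec_sub, Matrix.mulVec_smul,
    Sum.forall, Sum.elim_inl, Sum.elim_inr, Pi.sub_apply, Pi.smul_apply, smul_eq_mul,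
    Set.mem_ofPred_eq, Set.mem_uIcc] at hg hg2 hgS
  have hxg : ∀ j, ∃ k, x j + g j = 2 * k := fun j => by
    have := hg j
    exact exists_eq_mul_right_of_dvd (by omega)
  choose z hz using hxg
  have hAz : ∀ i, (A *ᵥ x) i + (A *ᵥ g) i = 2 * (A *ᵥ z) i := fun i => by
    have hxz : x + g = (2 : ℤ) • z := funext hz
    rw [← Pi.add_apply, ← Matrix.mulVec_add, hxz, Matrix.mulVec_smul, Pi.smul_apply, smul_eq_mul]
  refine ⟨z, fun i => ?_, fun j => ?_, fun i hi => ?_⟩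
  · have := abs_le.1 (hg2.1 i)
    have := hgS.1 i
    have := hAz i
    have := hxb i
    have := hyb i
    omega
  · rw [show x j - 2 * z j = -g j by linarith [hz j], abs_neg]
    exact hg2.2 j
  · have := hgS.1 i
    have := hAz i
    have := hyb i
    omega

theorem exists_int_norm_sub_le_one_of_half
    (hM : ∀ r : κ → ι ⊕ κ, ((withUnitRows A).submatrix r id).det.natAbs ≤ 2) {v : κ → ℝ}
    (hspan : SpanningRows ((withUnitRows A).map (Int.cast : ℤ → ℝ))
      {i | ∃ k : ℤ, ((withUnitRows A).map (Int.cast : ℤ → ℝ) *ᵥ v) i = k})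
    {x : κ → ℤ} (hvx : ∀ j, 2 * v j = x j) (hx : ∃ j, ¬2 ∣ x j)
    (hvb : ∀ i, (A.map (Int.cast : ℤ → ℝ) *ᵥ v) i ≤ b i) (hyb : ∀ i, (A *ᵥ y) i ≤ b i) :
    ∃ z : κ → ℤ, (∀ i, (A *ᵥ z) i ≤ b i) ∧ ‖v - fun j => (z j : ℝ)‖ ≤ 1 ∧
      ∀ i, (A.map (Int.cast : ℤ → ℝ) *ᵥ v) i = b i → (A *ᵥ y) i ≤ (A *ᵥ z) i := by
  have hxv : (fun j => (x j : ℝ)) = (2 : ℝ) • v := funext fun j => (hvx j).symm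
  have hAx : ∀ i, ((A *ᵥ x) i : ℝ) = 2 * (A.map (Int.cast : ℤ → ℝ) *ᵥ v) i := fun i => by
    rw [← map_intCast_mulVec, hxv, Matrix.mulVec_smul, Pi.smul_apply, smul_eq_mul]
  have hMx : ∀ i, ((withUnitRows A *ᵥ x) i : ℝ) =
      2 * ((withUnitRows A).map (Int.cast : ℤ → ℝ) *ᵥ v) i := fun i => by
    rw [← map_intCast_mulVec, hxv, Matrix.mulVec_smul, Pi.smul_apply, smul_eq_mul]
  have heven : SpanningRows _ {i | 2 ∣ (withUnitRows A *ᵥ x) i} := hspan.mono fun i hi => by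
    obtain ⟨k, hk⟩ := hi
    have h := hMx i
    rw [hk] at h
    exact ⟨k, by exact_mod_cast h⟩
  have hxb : ∀ i, (A *ᵥ x) i ≤ 2 * b i := fun i => by
    have h : ((A *ᵥ x) i : ℝ) ≤ 2 * b i := by linarith [hAx i, hvb i]
    exact_mod_cast h
  obtain ⟨z, hz, hxz, htight⟩ := exists_int_near_half hM heven hx hxb hyb
  refine ⟨z, hz, (pi_norm_le_iff_of_nonneg zero_le_one).2 fun j => ?_, fun i hi => htight i ?_⟩
  · have hxz' : |(x j : ℝ) - 2 * z j| ≤ 2 := by exact_mod_cast hxz j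
    rw [← hvx, ← mul_sub, abs_mul, abs_two] at hxz'
    rw [Pi.sub_apply, Real.norm_eq_abs]
    linarith
  · have h := hAx i
    rw [hi] at h
    exact_mod_cast h

theorem exists_int_norm_sub_le_of_spanningRows {d : ℕ} (hd : d ≤ 2)
    (hM : ∀ r : κ → ι ⊕ κ, ((withUnitRows A).submatrix r id).det.natAbs ≤ d) {v : κ → ℝ}
    (hspan : SpanningRows ((withUnitRows A).map (Int.cast : ℤ → ℝ))
      {i | ∃ k : ℤ, ((withUnitRows A).map (Int.cast : ℤ → ℝ) *ᵥ v) i = k})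
    (hvb : ∀ i, (A.map (Int.cast : ℤ → ℝ) *ᵥ v) i ≤ b i) (hyb : ∀ i, (A *ᵥ y) i ≤ b i) :
    ∃ z : κ → ℤ, (∀ i, (A *ᵥ z) i ≤ b i) ∧ ‖v - fun j => (z j : ℝ)‖ ≤ (d : ℝ) - 1 ∧
      ∀ i, (A.map (Int.cast : ℤ → ℝ) *ᵥ v) i = b i → (A *ᵥ y) i ≤ (A *ᵥ z) i := by
  obtain ⟨q, hq, hqd, x, hx⟩ := hspan.exists_mul_eq_intCast hM
  by_cases hv : ∃ z : κ → ℤ, v = fun j => (z j : ℝ)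
  · obtain ⟨z, rfl⟩ := hv
    simp only [map_intCast_mulVec, Int.cast_le, Int.cast_inj] at hvb ⊢
    refine ⟨z, hvb, ?_, fun i hi => (hyb i).trans_eq hi.symm⟩
    rw [sub_self, norm_zero, sub_nonneg]
    exact_mod_cast hq.trans hqd
  have hq1 : q ≠ 1 := by
    rintro rfl
    exact hv ⟨x, funext fun j => by simpa using hx j⟩
  obtain ⟨rfl, rfl⟩ : q = 2 ∧ d = 2 := by omega
  have hx2 : ∃ j, ¬2 ∣ x j := by
    by_contra! h
    choose z hz using h
    exact hv ⟨z, funext fun j => by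
      have := hx j
      rw [hz j] at this
      push_cast at this
      linarith⟩
  obtain ⟨z, hz, hvz, htight⟩ :=
    exists_int_norm_sub_le_one_of_half hM hspan (by exact_mod_cast hx) hx2 hvb hyb
  exact ⟨z, hz, hvz.trans_eq (by norm_num), htight⟩

theorem exists_int_norm_sub_le {d : ℕ} (hd : d ≤ 2)
    (hM : ∀ r : κ → ι ⊕ κ, ((withUnitRows A).submatrix r id).det.natAbs ≤ d) {w : κ → ℝ}
    (hwb : ∀ i, (A.map (Int.cast : ℤ → ℝ) *ᵥ w) i ≤ b i) (hyb : ∀ i, (A *ᵥ y) i ≤ b i) :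
    ∃ z : κ → ℤ, (∀ i, (A *ᵥ z) i ≤ b i) ∧ ‖w - fun j => (z j : ℝ)‖ ≤ d ∧
      ∀ i, (A.map (Int.cast : ℤ → ℝ) *ᵥ w) i = b i → (A *ᵥ y) i ≤ (A *ᵥ z) i := by
  have hinj : Function.Injective ((withUnitRows A).map (Int.cast : ℤ → ℝ)).mulVec := fun x x' h =>
    (Sum.elim_eq_iff.1 (by simpa only [map_withUnitRows_mulVec] using h)).2
  obtain ⟨v, hv, hspan⟩ := exists_floor_le_mulVec_le_ceil hinj w
  simp only [map_withUnitRows_mulVec, Sum.forall, Sum.elim_inl, Sum.elim_inr] at hv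
  obtain ⟨hAv, hwv⟩ := hv
  have hwv1 : ‖w - v‖ ≤ 1 := (pi_norm_le_iff_of_nonneg zero_le_one).2 fun j =>
    abs_sub_le_one_of_floor_le_of_le_ceil (hwv j).1 (hwv j).2
  have hvb : ∀ i, (A.map (Int.cast : ℤ → ℝ) *ᵥ v) i ≤ b i := fun i =>
    (hAv i).2.trans (Int.cast_le.2 (Int.ceil_le.2 (hwb i)))
  obtain ⟨z, hz, hvz, htight⟩ := exists_int_norm_sub_le_of_spanningRows hd hM hspan hvb hyb
  refine ⟨z, hz, ?_, fun i hi => htight i ((hvb i).antisymm ?_)⟩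
  · linarith [norm_sub_le_norm_sub_add_norm_sub w v fun j => (z j : ℝ)]
  · simpa [hi] using (hAv i).1

end Rounding

section MIP

variable {m n : ℕ} {A : Matrix (Fin m) (Fin n) ℤ} {b : Fin m → ℤ} {c : Fin n → ℝ}
  {I : Set (Fin n)} {w x y u : Fin n → ℝ}

theorem mem_mipFeasible_empty :
    x ∈ mipFeasible A b ∅ ↔ A.map (Int.cast : ℤ → ℝ) *ᵥ x ≤ fun i => (b i : ℝ) := by
  simp [mipFeasible, Pi.le_def]

theorem mem_mipFeasible_univ :
    x ∈ mipFeasible A b Set.univ ↔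
      ∃ y : Fin n → ℤ, (∀ i, (A *ᵥ y) i ≤ b i) ∧ x = fun j => (y j : ℝ) := by
  refine ⟨fun ⟨hA, hx⟩ => ?_, ?_⟩
  · choose y hy using fun j => hx j (Set.mem_univ j)
    obtain rfl : x = fun j => (y j : ℝ) := funext hy
    simp only [map_intCast_mulVec, Int.cast_le] at hA
    exact ⟨y, hA, rfl⟩
  · rintro ⟨y, hy, rfl⟩
    refine ⟨fun i => ?_, fun j _ => ⟨y j, rfl⟩⟩
    rw [map_intCast_mulVec]
    exact_mod_cast hy i

theorem exists_mem_mipFeasible_univ_norm_sub_le (hΔ_pos : 1 ≤ maxSubdet A) (hΔ : maxSubdet A ≤ 2)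
    (hw : w ∈ mipFeasible A b ∅) (hy : y ∈ mipFeasible A b Set.univ) :
    ∃ z ∈ mipFeasible A b Set.univ, ‖w - z‖ ≤ maxSubdet A ∧
      ∀ i, (A.map (Int.cast : ℤ → ℝ) *ᵥ w) i = b i →
        (A.map (Int.cast : ℤ → ℝ) *ᵥ (y - z)) i ≤ 0 := by
  obtain ⟨y, hyb, rfl⟩ := mem_mipFeasible_univ.1 hy
  have hM : ∀ r : Fin n → Fin m ⊕ Fin n,
      ((withUnitRows A).submatrix r id).det.natAbs ≤ maxSubdet A := fun r =>
    natAbs_det_submatrix_withUnitRows_le (natAbs_det_submatrix_le_maxSubdet hΔ_pos) n r id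
  obtain ⟨z, hz, hwz, htight⟩ := exists_int_norm_sub_le hΔ hM (mem_mipFeasible_empty.1 hw) hyb
  refine ⟨_, mem_mipFeasible_univ.2 ⟨z, hz, rfl⟩, hwz, fun i hi => ?_⟩
  rw [Matrix.mulVec_sub, Pi.sub_apply, map_intCast_mulVec, map_intCast_mulVec, sub_nonpos]
  exact_mod_cast htight i hi

theorem IsMIPOptimal.of_le (hx : IsMIPOptimal A b c I x) (hy : y ∈ mipFeasible A b I)
    (hxy : c ⬝ᵥ x ≤ c ⬝ᵥ y) : IsMIPOptimal A b c I y :=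
  ⟨hy, fun z hz => (hx.2 z hz).trans hxy⟩

theorem IsMIPOptimal.dotProduct_nonpos (hx : IsMIPOptimal A b c ∅ x)
    (hu : ∀ i, (A.map (Int.cast : ℤ → ℝ) *ᵥ x) i = b i →
      (A.map (Int.cast : ℤ → ℝ) *ᵥ u) i ≤ 0) : c ⬝ᵥ u ≤ 0 := by
  obtain ⟨ε, hε, hε_pos⟩ := (eventually_mulVec_add_smul_le
    (mem_mipFeasible_empty.1 hx.1) hu).and self_mem_nhdsWithin |>.exists
  have hle := hx.2 _ (mem_mipFeasible_empty.2 hε)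
  rw [dotProduct_add, dotProduct_smul, add_le_iff_nonpos_right, smul_eq_mul] at hle
  exact nonpos_of_mul_nonpos_right hle hε_pos

theorem exists_isMIPOptimal_univ_norm_sub_le (hΔ_pos : 1 ≤ maxSubdet A) (hΔ : maxSubdet A ≤ 2)
    (hw : IsMIPOptimal A b c ∅ w) (hy : IsMIPOptimal A b c Set.univ y) :
    ∃ z, IsMIPOptimal A b c Set.univ z ∧ ‖w - z‖ ≤ maxSubdet A := by
  obtain ⟨z, hz, hwz, htight⟩ := exists_mem_mipFeasible_univ_norm_sub_le hΔ_pos hΔ hw.1 hy.1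
  have hyz := hw.dotProduct_nonpos htight
  rw [dotProduct_sub, sub_nonpos] at hyz
  exact ⟨z, hy.of_le hz hyz, hwz⟩

theorem isClosed_setOf_isMIPOptimal : IsClosed {x | IsMIPOptimal A b c ∅ x} := by
  have hfeasible : IsClosed {x | x ∈ mipFeasible A b ∅} := by
    simp only [mem_mipFeasible_empty]
    exact isClosed_le (by fun_prop) continuous_const
  simp only [IsMIPOptimal, Set.ofPred_and, Set.ofPred_forall]
  exact hfeasible.inter (isClosed_biInter fun y _ => isClosed_le continuous_const (by fun_prop))

theorem exists_isMIPOptimal_empty_norm_sub_le (hΔ_pos : 1 ≤ maxSubdet A) (hΔ : maxSubdet A ≤ 2)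
    (hw : IsMIPOptimal A b c Set.univ w) (hx : IsMIPOptimal A b c ∅ x) :
    ∃ y, IsMIPOptimal A b c ∅ y ∧ ‖w - y‖ ≤ maxSubdet A := by
  obtain ⟨y, hy : IsMIPOptimal A b c ∅ y, hwy⟩ :=
    isClosed_setOf_isMIPOptimal.exists_infDist_eq_dist ⟨x, hx⟩ w
  refine ⟨y, hy, ?_⟩
  by_contra! hlt
  obtain ⟨z, hz, hyz, htight⟩ := exists_mem_mipFeasible_univ_norm_sub_le hΔ_pos hΔ hy.1 hw.1
  have hc : c ⬝ᵥ (w - z) = 0 := (hy.dotProduct_nonpos htight).antisymm (by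
    simpa [dotProduct_sub] using hw.2 z hz)
  obtain ⟨ε, ⟨hε, hε1⟩, hε0 : 0 < ε⟩ := ((eventually_mulVec_add_smul_le
    (mem_mipFeasible_empty.1 hy.1) htight).and (nhdsWithin_le_nhds (Iio_mem_nhds one_pos))).and
    self_mem_nhdsWithin |>.exists
  have hopt : y + ε • (w - z) ∈ {x | IsMIPOptimal A b c ∅ x} :=
    hy.of_le (mem_mipFeasible_empty.2 hε) (by simp [dotProduct_add, dotProduct_smul, hc])
  have hcloser : ‖w - (y + ε • (w - z))‖ < ‖w - y‖ := calc
    _ = ‖(1 - ε) • (w - y) + ε • (z - y)‖ := by congr 1; module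
    _ ≤ (1 - ε) * ‖w - y‖ + ε * ‖z - y‖ := by
      refine (norm_add_le _ _).trans_eq ?_
      rw [norm_smul_of_nonneg (sub_nonneg.2 (le_of_lt hε1)), norm_smul_of_nonneg hε0.le]
    _ < (1 - ε) * ‖w - y‖ + ε * ‖w - y‖ := by
      rw [norm_sub_rev z]
      gcongr
      exact hyz.trans_lt hlt
    _ = ‖w - y‖ := by ring
  rw [← dist_eq_norm, ← dist_eq_norm, ← hwy] at hcloser
  exact (Metric.infDist_le_dist_of_mem hopt).not_gt hcloser

end MIP

theorem proposition6 {m n : ℕ} (A : Matrix (Fin m) (Fin n) ℤ) (b : Fin m → ℤ) (c : Fin n → ℝ)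
    (hΔ_pos : 1 ≤ maxSubdet A) (hΔ : maxSubdet A ≤ 2)
    (I J : Set (Fin n)) (hI : I = ∅ ∨ I = Set.univ) (hJ : J = ∅ ∨ J = Set.univ)
    (hJopt : ∃ z, IsMIPOptimal A b c J z)
    (w : Fin n → ℝ) (hw : IsMIPOptimal A b c I w) :
    ∃ z : Fin n → ℝ, IsMIPOptimal A b c J z ∧ ‖w - z‖ ≤ (maxSubdet A : ℝ) := by
  obtain ⟨y, hy⟩ := hJopt
  obtain rfl | rfl := hI <;> obtain rfl | rfl := hJ
  · exact ⟨w, hw, by simp⟩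
  · exact exists_isMIPOptimal_univ_norm_sub_le hΔ_pos hΔ hw hy
  · exact exists_isMIPOptimal_empty_norm_sub_le hΔ_pos hΔ hw hy
  · exact ⟨w, hw, by simp⟩
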